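/- Let $\mathbb{Z}[i]$ be the Gaussian integers, let $X=\{u(1+i)+v(1-i) : -\tfrac12\le u,v<\tfrac12\}$, and let $\overline X$, $X^{\circ}$ be its closure and interior. For $0\le k<4$ put $L(i^k(1+i))=\{i^k(1+i)m : m\in\mathbb{Z}_{>0}\}$ and $L(2i^k)=\{i^k(m(1+i)+l(1-i)) : m,l\in\mathbb{Z}_{>0}\}$; these eight sets partition $(1+i)\mathbb{Z}[i]\setminus\{0\}$. For $w\in(1+i)\mathbb{Z}[i]$ define $Q_w\subset\mathbb{C}$ by: * $Q_0=\overline X$; * if $w\in L(i^k(1+i))$, then $Q_w$ is the union of $X^{\circ}+w$, of the two sides $\{i^k(u(1+i)\pm\tfrac12(1-i))+w : -\tfrac12<u\le\tfrac12\}$, and of the side $\{i^k(\tfrac12(1+i)+u(1-i))+w : -\tfrac12\le u\le\tfrac12\}$; * if $w\in L(2i^k)$, then $Q_w$ is the union of $X^{\circ}+w$, of the side $\{i^k(u(1+i)+\tfrac12(1-i))+w : -\tfrac12<u\le\tfrac12\}$, and of the side $\{i^k(\tfrac12(1+i)+u(1-i))+w : -\tfrac12<u\le\tfrac12\}$. The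 sets $Q_w$ partition $\mathbb{C}$. For $z\in\mathbb{C}\setminus\mathbb{Z}[i]$ let $\lfloor z\rfloor_H$ be the unique $w\in(1+i)\mathbb{Z}[i]$ with $z\in Q_w$, and for $z\in\mathbb{Z}[i]$ let $\lfloor z\rfloor_H=z$. J. Hurwitz's algorithm assigns to $\alpha\in\overline X$ the sequences defined by $\alpha_{(1)}=\alpha$ and, as long as $\alpha_{(n)}\ne0$, $a_n=\lfloor 1/\alpha_{(n)}\rfloor_H$ and $\alpha_{(n+1)}=1/\alpha_{(n)}-a_n$; it terminates if $\alpha_{(n)}=0$. **Theorem.** Let $m,n$ be integers and let $\sqrt{m+ni}$ denote either of the complex square roots of $m+ni$. Assume $\sqrt{m+ni}\notin\mathbb{Q}(i)$, and let $\alpha=\sqrt{m+ni}-\lfloor\sqrt{m+ni}\rfloor_H$. Then $\alpha\in\overline X$, and the J. Hurwitz continued fraction expansion of $\alpha$ is purely periodic: the algorithm never terminates, that is, $\alpha_{(j)}\neq0$ for all $j\ge1$, and there is an integer $l\ge1$ such that $\alpha_{(j+l)}=\alpha_{(j)}$ and $a_{j+l}=a_j$ for all $j\ge1$. -/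

import Mathlib

noncomputable section

namespace JHurwitz

/-- The Gaussian numbers `ℚ(i)`, as a subset of `ℂ`. -/
def gaussianRationals : Set ℂ := {z | ∃ p q : ℚ, z = (p : ℂ) + (q : ℂ) * Complex.I}

/-- The Gaussian integers `ℤ[i]`, as a subset of `ℂ`. -/
def gaussianIntegers : Set ℂ := {z | ∃ p q : ℤ, z = (p : ℂ) + (q : ℂ) * Complex.I}

/-- The ideal `(1 + i) ℤ[i]`, as a subset of `ℂ`. -/
def evenGaussianIntegers : Set ℂ := {w | ∃ g ∈ gaussianIntegers, w = (1 + Complex.I) * g}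

/-- The point `u (1 + i) + v (1 - i)`. -/
def pt (u v : ℝ) : ℂ := (u : ℂ) * (1 + Complex.I) + (v : ℂ) * (1 - Complex.I)

/-- The half-open square `X = {u (1 + i) + v (1 - i) | -1/2 ≤ u, v < 1/2}`. -/
def X : Set ℂ :=
  {z | ∃ u v : ℝ, (-(1 / 2) ≤ u ∧ u < 1 / 2) ∧ (-(1 / 2) ≤ v ∧ v < 1 / 2) ∧ z = pt u v}

/-- `L(i ^ k (1 + i)) = i ^ k (1 + i) ℤ_{> 0}`. -/
def axisDigits (k : ℕ) : Set ℂ :=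
  {w | ∃ m : ℤ, 0 < m ∧ w = Complex.I ^ k * ((1 + Complex.I) * (m : ℂ))}

/-- `L(2 i ^ k) = {i ^ k (m (1 + i) + l (1 - i)) | m, l ∈ ℤ_{> 0}}`. -/
def quadrantDigits (k : ℕ) : Set ℂ :=
  {w | ∃ m l : ℤ, 0 < m ∧ 0 < l ∧
    w = Complex.I ^ k * ((m : ℂ) * (1 + Complex.I) + (l : ℂ) * (1 - Complex.I))}

/-- The cell `Q_w` for `w ∈ L(i ^ k (1 + i))`: the open square centred at `w` with three sides. -/
def axisCell (k : ℕ) (w : ℂ) : Set ℂ :=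
  {z | z - w ∈ interior X} ∪
  {z | ∃ u : ℝ, -(1 / 2) < u ∧ u ≤ 1 / 2 ∧ z = Complex.I ^ k * pt u (-(1 / 2)) + w} ∪
  {z | ∃ u : ℝ, -(1 / 2) ≤ u ∧ u ≤ 1 / 2 ∧ z = Complex.I ^ k * pt (1 / 2) u + w} ∪
  {z | ∃ u : ℝ, -(1 / 2) < u ∧ u ≤ 1 / 2 ∧ z = Complex.I ^ k * pt u (1 / 2) + w}

/-- The cell `Q_w` for `w ∈ L(2 i ^ k)`: the open square centred at `w` with two sides. -/
def quadrantCell (k : ℕ) (w : ℂ) : Set ℂ :=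
  {z | z - w ∈ interior X} ∪
  {z | ∃ u : ℝ, -(1 / 2) < u ∧ u ≤ 1 / 2 ∧ z = Complex.I ^ k * pt u (1 / 2) + w} ∪
  {z | ∃ u : ℝ, -(1 / 2) < u ∧ u ≤ 1 / 2 ∧ z = Complex.I ^ k * pt (1 / 2) u + w}

/-- The cell `Q_w` of `w ∈ (1 + i) ℤ[i]`; here `Q_0` is the closed square. -/
def cell (w : ℂ) : Set ℂ :=
  {z | (w = 0 ∧ z ∈ closure X) ∨
    ∃ k < 4, (w ∈ axisDigits k ∧ z ∈ axisCell k w) ∨ (w ∈ quadrantDigits k ∧ z ∈ quadrantCell k w)}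

section wellDefined

open Complex

/-- Coordinates with respect to `1 + i`, `1 - i`. -/
def coords : ℂ ≃ₜ ℝ × ℝ where
  toFun z := ((z.re + z.im) / 2, (z.re - z.im) / 2)
  invFun p := pt p.1 p.2
  left_inv z := by
    apply Complex.ext <;> simp [pt] <;> ring
  right_inv p := by
    ext <;> simp [pt] <;> ring
  continuous_toFun := by fun_prop
  continuous_invFun := by unfold pt; fun_prop

theorem coords_pt (u v : ℝ) : coords (pt u v) = (u, v) := coords.right_inv (u, v)

theorem X_eq : X = coords ⁻¹' (Set.Ico (-(1 / 2)) (1 / 2) ×ˢ Set.Ico (-(1 / 2)) (1 / 2)) := by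
  ext z
  constructor
  · rintro ⟨u, v, hu, hv, rfl⟩
    rw [Set.mem_preimage, coords_pt]
    exact ⟨hu, hv⟩
  · intro h
    exact ⟨(coords z).1, (coords z).2, h.1, h.2, (coords.left_inv z).symm⟩

theorem closure_X :
    closure X = coords ⁻¹' (Set.Icc (-(1 / 2)) (1 / 2) ×ˢ Set.Icc (-(1 / 2)) (1 / 2)) := by
  rw [X_eq, ← coords.preimage_closure, closure_prod_eq, closure_Ico (by norm_num)]

theorem interior_X :
    interior X = coords ⁻¹' (Set.Ioo (-(1 / 2)) (1 / 2) ×ˢ Set.Ioo (-(1 / 2)) (1 / 2)) := by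
  rw [X_eq, ← coords.preimage_interior, interior_prod_eq, interior_Ico]

/-- `a` is an integer nearest to `x`, the smaller in absolute value in case of a tie. -/
def Near (a : ℤ) (x : ℝ) : Prop :=
  (a ≤ 0 → (a : ℝ) - 1 / 2 ≤ x) ∧ (0 < a → (a : ℝ) - 1 / 2 < x) ∧
  (0 ≤ a → x ≤ a + 1 / 2) ∧ (a < 0 → x < a + 1 / 2)

theorem near_existsUnique (x : ℝ) : ∃! a : ℤ, Near a x := by
  rcases le_total 0 x with hx | hx
  · refine ⟨⌈x - 1 / 2⌉, ?_, ?_⟩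
    · have h1 := Int.le_ceil (x - 1 / 2)
      have h2 := Int.ceil_lt_add_one (x - 1 / 2)
      have h0 : 0 ≤ ⌈x - 1 / 2⌉ := by
        have : -1 < ⌈x - 1 / 2⌉ := by
          rw [Int.lt_ceil]; push_cast; linarith
        omega
      exact ⟨fun _ => by linarith, fun _ => by linarith, fun _ => by linarith, fun h => by omega⟩
    · rintro a ⟨h1, h2, h3, h4⟩
      symm
      rw [Int.ceil_eq_iff]
      rcases lt_trichotomy a 0 with h | h | h
      · have := h4 h
        have h' : (a : ℝ) ≤ -1 := by exact_mod_cast Int.le_sub_one_of_lt h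
        linarith
      · subst h
        have := h3 le_rfl
        push_cast at *
        constructor <;> linarith
      · have := h2 h
        have := h3 h.le
        constructor <;> linarith
  · refine ⟨⌊x + 1 / 2⌋, ?_, ?_⟩
    · have h1 := Int.floor_le (x + 1 / 2)
      have h2 := Int.lt_floor_add_one (x + 1 / 2)
      have h0 : ⌊x + 1 / 2⌋ ≤ 0 := by
        have : ⌊x + 1 / 2⌋ < 1 := by
          rw [Int.floor_lt]; push_cast; linarith
        omega
      exact ⟨fun _ => by linarith, fun h => by omega, fun _ => by linarith, fun _ => by linarith⟩
    · rintro a ⟨h1, h2, h3, h4⟩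
      symm
      rw [Int.floor_eq_iff]
      rcases lt_trichotomy a 0 with h | h | h
      · have := h4 h
        have := h1 h.le
        constructor <;> linarith
      · subst h
        have := h1 le_rfl
        push_cast at *
        constructor <;> linarith
      · have := h2 h
        have h' : (1 : ℝ) ≤ a := by exact_mod_cast h
        linarith

theorem pt_inj {u v u' v' : ℝ} : pt u v = pt u' v' ↔ u = u' ∧ v = v' := by
  constructor
  · intro h
    have := congrArg coords h
    rwa [coords_pt, coords_pt, Prod.mk.injEq] at this
  · rintro ⟨rfl, rfl⟩; rfl

theorem pt_add (u v u' v' : ℝ) : pt u v + pt u' v' = pt (u + u') (v + v') := by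
  simp only [pt]; push_cast; ring

theorem pt_sub (u v u' v' : ℝ) : pt u v - pt u' v' = pt (u - u') (v - v') := by
  simp only [pt]; push_cast; ring

theorem rot0 (u v : ℝ) : I ^ 0 * pt u v = pt u v := by simp

theorem rot1 (u v : ℝ) : I ^ 1 * pt u v = pt v (-u) := by
  apply Complex.ext <;> simp [pt] <;> ring

theorem rot2 (u v : ℝ) : I ^ 2 * pt u v = pt (-u) (-v) := by
  apply Complex.ext <;> simp [pt] <;> ring

theorem rot3 (u v : ℝ) : I ^ 3 * pt u v = pt (-v) u := by
  rw [I_pow_three]; apply Complex.ext <;> simp [pt] <;> ring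

theorem axis_eq (m : ℤ) : (1 + I) * (m : ℂ) = pt m 0 := by
  simp only [pt]; push_cast; ring

theorem quadrant_eq (m l : ℤ) : (m : ℂ) * (1 + I) + (l : ℂ) * (1 - I) = pt m l := by
  simp only [pt]; push_cast; ring

theorem pt_mem_closure {u v : ℝ} : pt u v ∈ closure X ↔
    (-(1 / 2) ≤ u ∧ u ≤ 1 / 2) ∧ (-(1 / 2) ≤ v ∧ v ≤ 1 / 2) := by
  rw [closure_X, Set.mem_preimage, coords_pt]; rfl

theorem pt_mem_interior {u v : ℝ} : pt u v ∈ interior X ↔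
    (-(1 / 2) < u ∧ u < 1 / 2) ∧ (-(1 / 2) < v ∧ v < 1 / 2) := by
  rw [interior_X, Set.mem_preimage, coords_pt]; rfl

theorem pt_eq_zero {u v : ℝ} : pt u v = 0 ↔ u = 0 ∧ v = 0 := by
  have : (0 : ℂ) = pt 0 0 := by simp [pt]
  rw [this, pt_inj]

theorem pt_mem_axisDigits (a b : ℤ) (k : ℕ) : pt a b ∈ axisDigits k ↔
    ∃ m : ℤ, 0 < m ∧ pt a b = I ^ k * pt m 0 := by
  simp only [axisDigits, axis_eq, Set.mem_setOf_eq]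

theorem pt_mem_quadrantDigits (a b : ℤ) (k : ℕ) : pt a b ∈ quadrantDigits k ↔
    ∃ m l : ℤ, 0 < m ∧ 0 < l ∧ pt a b = I ^ k * pt m l := by
  simp only [quadrantDigits, quadrant_eq, Set.mem_setOf_eq]

theorem pt_mem_axisCell (k : ℕ) (x y a b : ℝ) : pt x y ∈ axisCell k (pt a b) ↔
    ((((-(1 / 2) < x - a ∧ x - a < 1 / 2) ∧ (-(1 / 2) < y - b ∧ y - b < 1 / 2)) ∨
    (∃ u : ℝ, -(1 / 2) < u ∧ u ≤ 1 / 2 ∧ pt x y = I ^ k * pt u (-(1 / 2)) + pt a b)) ∨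
    (∃ u : ℝ, -(1 / 2) ≤ u ∧ u ≤ 1 / 2 ∧ pt x y = I ^ k * pt (1 / 2) u + pt a b)) ∨
    (∃ u : ℝ, -(1 / 2) < u ∧ u ≤ 1 / 2 ∧ pt x y = I ^ k * pt u (1 / 2) + pt a b) := by
  simp only [axisCell, Set.mem_union, Set.mem_setOf_eq, pt_sub, pt_mem_interior]

theorem pt_mem_quadrantCell (k : ℕ) (x y a b : ℝ) : pt x y ∈ quadrantCell k (pt a b) ↔
    (((-(1 / 2) < x - a ∧ x - a < 1 / 2) ∧ (-(1 / 2) < y - b ∧ y - b < 1 / 2)) ∨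
    (∃ u : ℝ, -(1 / 2) < u ∧ u ≤ 1 / 2 ∧ pt x y = I ^ k * pt u (1 / 2) + pt a b)) ∨
    (∃ u : ℝ, -(1 / 2) < u ∧ u ≤ 1 / 2 ∧ pt x y = I ^ k * pt (1 / 2) u + pt a b) := by
  simp only [quadrantCell, Set.mem_union, Set.mem_setOf_eq, pt_sub, pt_mem_interior]

theorem axisCell_iff (x y a b : ℝ) :
    (pt x y ∈ axisCell 0 (pt a b) ↔
      (-(1 / 2) < x - a ∧ x - a ≤ 1 / 2) ∧ (-(1 / 2) ≤ y - b ∧ y - b ≤ 1 / 2)) ∧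
    (pt x y ∈ axisCell 1 (pt a b) ↔
      (-(1 / 2) ≤ x - a ∧ x - a ≤ 1 / 2) ∧ (-(1 / 2) ≤ y - b ∧ y - b < 1 / 2)) ∧
    (pt x y ∈ axisCell 2 (pt a b) ↔
      (-(1 / 2) ≤ x - a ∧ x - a < 1 / 2) ∧ (-(1 / 2) ≤ y - b ∧ y - b ≤ 1 / 2)) ∧
    (pt x y ∈ axisCell 3 (pt a b) ↔
      (-(1 / 2) ≤ x - a ∧ x - a ≤ 1 / 2) ∧ (-(1 / 2) < y - b ∧ y - b ≤ 1 / 2)) := by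
  refine ⟨?_, ?_, ?_, ?_⟩ <;> rw [pt_mem_axisCell] <;>
    simp only [rot0, rot1, rot2, rot3, pt_add, pt_inj]
  · constructor
    · rintro (((h | ⟨u, h⟩) | ⟨u, h⟩) | ⟨u, h⟩) <;> grind
    · intro h
      by_cases h1 : y - b = -(1 / 2)
      · exact Or.inl (Or.inl (Or.inr ⟨x - a, by grind⟩))
      by_cases h2 : y - b = 1 / 2
      · exact Or.inr ⟨x - a, by grind⟩
      by_cases h3 : x - a = 1 / 2
      · exact Or.inl (Or.inr ⟨y - b, by grind⟩)
      exact Or.inl (Or.inl (Or.inl (by grind)))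
  · constructor
    · rintro (((h | ⟨u, h⟩) | ⟨u, h⟩) | ⟨u, h⟩) <;> grind
    · intro h
      by_cases h1 : x - a = -(1 / 2)
      · exact Or.inl (Or.inl (Or.inr ⟨-(y - b), by grind⟩))
      by_cases h2 : x - a = 1 / 2
      · exact Or.inr ⟨-(y - b), by grind⟩
      by_cases h3 : y - b = -(1 / 2)
      · exact Or.inl (Or.inr ⟨x - a, by grind⟩)
      exact Or.inl (Or.inl (Or.inl (by grind)))
  · constructor
    · rintro (((h | ⟨u, h⟩) | ⟨u, h⟩) | ⟨u, h⟩) <;> grind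
    · intro h
      by_cases h1 : y - b = 1 / 2
      · exact Or.inl (Or.inl (Or.inr ⟨-(x - a), by grind⟩))
      by_cases h2 : y - b = -(1 / 2)
      · exact Or.inr ⟨-(x - a), by grind⟩
      by_cases h3 : x - a = -(1 / 2)
      · exact Or.inl (Or.inr ⟨-(y - b), by grind⟩)
      exact Or.inl (Or.inl (Or.inl (by grind)))
  · constructor
    · rintro (((h | ⟨u, h⟩) | ⟨u, h⟩) | ⟨u, h⟩) <;> grind
    · intro h
      by_cases h1 : x - a = 1 / 2
      · exact Or.inl (Or.inl (Or.inr ⟨y - b, by grind⟩))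
      by_cases h2 : x - a = -(1 / 2)
      · exact Or.inr ⟨y - b, by grind⟩
      by_cases h3 : y - b = 1 / 2
      · exact Or.inl (Or.inr ⟨-(x - a), by grind⟩)
      exact Or.inl (Or.inl (Or.inl (by grind)))

theorem quadrantCell_iff (x y a b : ℝ) :
    (pt x y ∈ quadrantCell 0 (pt a b) ↔
      (-(1 / 2) < x - a ∧ x - a ≤ 1 / 2) ∧ (-(1 / 2) < y - b ∧ y - b ≤ 1 / 2)) ∧
    (pt x y ∈ quadrantCell 1 (pt a b) ↔
      (-(1 / 2) < x - a ∧ x - a ≤ 1 / 2) ∧ (-(1 / 2) ≤ y - b ∧ y - b < 1 / 2)) ∧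
    (pt x y ∈ quadrantCell 2 (pt a b) ↔
      (-(1 / 2) ≤ x - a ∧ x - a < 1 / 2) ∧ (-(1 / 2) ≤ y - b ∧ y - b < 1 / 2)) ∧
    (pt x y ∈ quadrantCell 3 (pt a b) ↔
      (-(1 / 2) ≤ x - a ∧ x - a < 1 / 2) ∧ (-(1 / 2) < y - b ∧ y - b ≤ 1 / 2)) := by
  refine ⟨?_, ?_, ?_, ?_⟩ <;> rw [pt_mem_quadrantCell] <;>
    simp only [rot0, rot1, rot2, rot3, pt_add, pt_inj]
  · constructor
    · rintro ((h | ⟨u, h⟩) | ⟨u, h⟩) <;> grind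
    · intro h
      by_cases h2 : y - b = 1 / 2
      · exact Or.inl (Or.inr ⟨x - a, by grind⟩)
      by_cases h3 : x - a = 1 / 2
      · exact Or.inr ⟨y - b, by grind⟩
      exact Or.inl (Or.inl (by grind))
  · constructor
    · rintro ((h | ⟨u, h⟩) | ⟨u, h⟩) <;> grind
    · intro h
      by_cases h2 : x - a = 1 / 2
      · exact Or.inl (Or.inr ⟨-(y - b), by grind⟩)
      by_cases h3 : y - b = -(1 / 2)
      · exact Or.inr ⟨x - a, by grind⟩
      exact Or.inl (Or.inl (by grind))
  · constructor
    · rintro ((h | ⟨u, h⟩) | ⟨u, h⟩) <;> grind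
    · intro h
      by_cases h2 : y - b = -(1 / 2)
      · exact Or.inl (Or.inr ⟨-(x - a), by grind⟩)
      by_cases h3 : x - a = -(1 / 2)
      · exact Or.inr ⟨-(y - b), by grind⟩
      exact Or.inl (Or.inl (by grind))
  · constructor
    · rintro ((h | ⟨u, h⟩) | ⟨u, h⟩) <;> grind
    · intro h
      by_cases h2 : x - a = -(1 / 2)
      · exact Or.inl (Or.inr ⟨y - b, by grind⟩)
      by_cases h3 : y - b = 1 / 2
      · exact Or.inr ⟨-(x - a), by grind⟩
      exact Or.inl (Or.inl (by grind))

theorem axisDigits_iff (a b : ℤ) :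
    (pt a b ∈ axisDigits 0 ↔ 0 < a ∧ b = 0) ∧ (pt a b ∈ axisDigits 1 ↔ a = 0 ∧ b < 0) ∧
    (pt a b ∈ axisDigits 2 ↔ a < 0 ∧ b = 0) ∧ (pt a b ∈ axisDigits 3 ↔ a = 0 ∧ 0 < b) := by
  refine ⟨?_, ?_, ?_, ?_⟩ <;> rw [pt_mem_axisDigits] <;>
    simp only [rot0, rot1, rot2, rot3, pt_inj] <;> norm_cast
  · exact ⟨by rintro ⟨m, h⟩; omega, fun h => ⟨a, by omega⟩⟩
  · exact ⟨by rintro ⟨m, h⟩; omega, fun h => ⟨-b, by omega⟩⟩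
  · simp only [neg_zero]; norm_cast
    exact ⟨by rintro ⟨m, h⟩; omega, fun h => ⟨-a, by omega⟩⟩
  · simp only [neg_zero]; norm_cast
    exact ⟨by rintro ⟨m, h⟩; omega, fun h => ⟨b, by omega⟩⟩

theorem quadrantDigits_iff (a b : ℤ) :
    (pt a b ∈ quadrantDigits 0 ↔ 0 < a ∧ 0 < b) ∧ (pt a b ∈ quadrantDigits 1 ↔ 0 < a ∧ b < 0) ∧
    (pt a b ∈ quadrantDigits 2 ↔ a < 0 ∧ b < 0) ∧
    (pt a b ∈ quadrantDigits 3 ↔ a < 0 ∧ 0 < b) := by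
  refine ⟨?_, ?_, ?_, ?_⟩ <;> rw [pt_mem_quadrantDigits] <;>
    simp only [rot0, rot1, rot2, rot3, pt_inj] <;> norm_cast
  · exact ⟨by rintro ⟨m, l, h⟩; omega, fun h => ⟨a, b, by omega⟩⟩
  · exact ⟨by rintro ⟨m, l, h⟩; omega, fun h => ⟨-b, a, by omega⟩⟩
  · exact ⟨by rintro ⟨m, l, h⟩; omega, fun h => ⟨-a, -b, by omega⟩⟩
  · exact ⟨by rintro ⟨m, l, h⟩; omega, fun h => ⟨b, -a, by omega⟩⟩

theorem near_zero (x : ℝ) : Near 0 x ↔ -(1 / 2) ≤ x ∧ x ≤ 1 / 2 := by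
  simp [Near]

theorem near_pos {a : ℤ} (h : 0 < a) (x : ℝ) : Near a x ↔ -(1 / 2) < x - a ∧ x - a ≤ 1 / 2 := by
  simp only [Near, h, h.le, not_le.2 h, not_lt.2 h.le, true_imp_iff, false_imp_iff, true_and,
    and_true]
  constructor <;> rintro ⟨h1, h2⟩ <;> constructor <;> linarith

theorem near_neg {a : ℤ} (h : a < 0) (x : ℝ) : Near a x ↔ -(1 / 2) ≤ x - a ∧ x - a < 1 / 2 := by
  simp only [Near, h, h.le, not_le.2 h, not_lt.2 h.le, true_imp_iff, false_imp_iff, true_and,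
    and_true]
  constructor <;> rintro ⟨h1, h2⟩ <;> constructor <;> linarith

theorem exists_lt_four {p : ℕ → Prop} : (∃ k < 4, p k) ↔ p 0 ∨ p 1 ∨ p 2 ∨ p 3 := by
  constructor
  · rintro ⟨k, hk, h⟩
    interval_cases k <;> tauto
  · rintro (h | h | h | h)
    exacts [⟨0, by norm_num, h⟩, ⟨1, by norm_num, h⟩, ⟨2, by norm_num, h⟩, ⟨3, by norm_num, h⟩]

theorem pt_mem_cell (x y : ℝ) (a b : ℤ) :
    pt x y ∈ cell (pt a b) ↔ Near a x ∧ Near b y := by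
  obtain ⟨c0, c1, c2, c3⟩ := axisCell_iff x y a b
  obtain ⟨q0, q1, q2, q3⟩ := quadrantCell_iff x y a b
  obtain ⟨d0, d1, d2, d3⟩ := axisDigits_iff a b
  obtain ⟨e0, e1, e2, e3⟩ := quadrantDigits_iff a b
  have hz : pt (a : ℝ) (b : ℝ) = 0 ↔ a = 0 ∧ b = 0 := by rw [pt_eq_zero]; norm_cast
  simp only [cell, Set.mem_setOf_eq, exists_lt_four, c0, c1, c2, c3, q0, q1, q2, q3, d0, d1, d2,
    d3, e0, e1, e2, e3, hz, pt_mem_closure]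
  rcases lt_trichotomy a 0 with ha | rfl | ha <;> rcases lt_trichotomy b 0 with hb | rfl | hb <;>
    simp [near_zero, near_pos, near_neg, *, not_lt.2, LT.lt.le, LT.lt.ne, LT.lt.ne']

theorem mem_evenGaussianIntegers {w : ℂ} :
    w ∈ evenGaussianIntegers ↔ ∃ a b : ℤ, w = pt a b := by
  constructor
  · rintro ⟨_, ⟨p, q, rfl⟩, rfl⟩
    refine ⟨p, -q, ?_⟩
    apply Complex.ext <;> simp [pt] <;> ring
  · rintro ⟨a, b, rfl⟩
    refine ⟨a + (-b : ℤ) * I, ⟨a, -b, rfl⟩, ?_⟩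
    apply Complex.ext <;> simp [pt] <;> ring

/-- The cells `Q_w`, for `w ∈ (1 + i) ℤ[i]`, partition the plane. -/
theorem cell_existsUnique (z : ℂ) : ∃! w : ℂ, w ∈ evenGaussianIntegers ∧ z ∈ cell w := by
  obtain ⟨x, y, rfl⟩ : ∃ x y, z = pt x y := ⟨_, _, (coords.left_inv z).symm⟩
  obtain ⟨a, ha, ha'⟩ := near_existsUnique x
  obtain ⟨b, hb, hb'⟩ := near_existsUnique y
  refine ⟨pt a b, ⟨mem_evenGaussianIntegers.2 ⟨a, b, rfl⟩, (pt_mem_cell x y a b).2 ⟨ha, hb⟩⟩, ?_⟩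
  rintro w ⟨hw, hz⟩
  obtain ⟨a', b', rfl⟩ := mem_evenGaussianIntegers.1 hw
  obtain ⟨h1, h2⟩ := (pt_mem_cell x y a' b').1 hz
  rw [ha' a' h1, hb' b' h2]

end wellDefined

open Classical in
/-- `⌊z⌋_H`: the unique `w ∈ (1 + i) ℤ[i]` with `z ∈ Q_w` if `z ∉ ℤ[i]`, and `z` if `z ∈ ℤ[i]`. -/
def floorH (z : ℂ) : ℂ :=
  if z ∈ gaussianIntegers then z else (cell_existsUnique z).choose

theorem floorH_of_mem {z : ℂ} (hz : z ∈ gaussianIntegers) : floorH z = z := if_pos hz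

theorem floorH_eq_iff {z : ℂ} (hz : z ∉ gaussianIntegers) (w : ℂ) :
    floorH z = w ↔ w ∈ evenGaussianIntegers ∧ z ∈ cell w := by
  rw [floorH, if_neg hz]
  constructor
  · rintro rfl
    exact (cell_existsUnique z).choose_spec.1
  · intro h
    exact ((cell_existsUnique z).choose_spec.2 w h).symm

open Classical in
/-- The transformation `T_H`; it maps `closure X` to itself. -/
def TH (z : ℂ) : ℂ := if z = 0 then 0 else 1 / z - floorH (1 / z)

open Classical in
/-- The partial quotient `a_H(z)`. -/
def aH (z : ℂ) : ℂ := if z = 0 then 0 else floorH (1 / z)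

/-- The `n`-th complete quotient `α_(n)`, for `n ≥ 1`, with `α_(1) = α`. The algorithm terminates
at the first `n` with `α_(n) = 0` (from there on, this sequence is constantly `0`). -/
def alphaH (α : ℂ) (n : ℕ) : ℂ := TH^[n - 1] α

/-- The `n`-th partial quotient `a_n`, for `n ≥ 1`. -/
def digitH (α : ℂ) (n : ℕ) : ℂ := aH (alphaH α n)

/-- The sequence `(α_(n))_{n ≥ 1}` generated from `α` is purely periodic: `α` belongs to the domain
`closure X` of the algorithm, the algorithm never terminates, and for some `l ≥ 1` the complete
quotients, and with them the partial quotients, repeat with period `l` from `n = 1` on. -/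
def IsPurelyPeriodicH (α : ℂ) : Prop :=
  α ∈ closure X ∧ (∀ n, 1 ≤ n → alphaH α n ≠ 0) ∧
    ∃ l, 1 ≤ l ∧ ∀ n, 1 ≤ n →
      alphaH α (n + l) = alphaH α n ∧ digitH α (n + l) = digitH α n

end JHurwitz

end

namespace JHurwitz

open GaussianInt

/-! The proof follows Galois' argument for pure periodicity. Conjugation here is that of `ℚ(i)(β)`
over `ℚ(i)`, which sends β to -β. Attach to a quadratic irrational z the number w, minus its
conjugate (`NegConj`). A step z ↦ 1/z - a of the algorithm acts on the second variable by w ↦ 1/w +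
a. A pair is `Reduced` when z lies in the closed square and w lies outside the closed unit disc and
outside those closed unit discs that the digit of z excludes.

Three facts carry the argument. Reduced pairs map to reduced pairs (`Reduced.step`). The previous
digit can be read off from 1/w + a, because the translated inverted fibres are disjoint, so `TH` is
injective on reduced points (`Reduced.TH_inj`). For a given β there are only finitely many reduced
points (`finite_reduced`). Hence `TH` permutes a finite set and each reduced point is purely
periodic.

For α = β - ⌊β⌋ the second variable is β + ⌊β⌋, and the pair is reduced as soon as |β| > 1. If |β| =
1, then β² = ±i and w can lie on the boundary of its fibre; there an explicit cycle of length two is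
exhibited. -/

/-- The integer nearest to `x`, the smaller in absolute value in case of a tie. -/
noncomputable def nearInt (x : ℝ) : ℤ := (near_existsUnique x).choose

theorem near_nearInt (x : ℝ) : Near (nearInt x) x := (near_existsUnique x).choose_spec.1

theorem nearInt_eq {x : ℝ} {a : ℤ} (h : Near a x) : nearInt x = a :=
  ((near_existsUnique x).choose_spec.2 a h).symm

theorem Near.abs_sub_le {a : ℤ} {x : ℝ} (h : Near a x) :
    -(1 / 2) ≤ x - a ∧ x - a ≤ 1 / 2 := by
  rcases lt_trichotomy a 0 with ha | rfl | ha
  · have := (near_neg ha x).1 h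
    exact ⟨this.1, this.2.le⟩
  · simpa using (near_zero x).1 h
  · have := (near_pos ha x).1 h
    exact ⟨this.1.le, this.2⟩

theorem Near.nonneg {a : ℤ} {x : ℝ} (h : Near a x) (hx : -(1 / 2) ≤ x) : 0 ≤ a := by
  by_contra! ha
  have h1 := h.2.2.2 ha
  have h2 : (a : ℝ) ≤ -1 := by exact_mod_cast Int.le_sub_one_of_lt ha
  linarith

theorem Near.nonpos {a : ℤ} {x : ℝ} (h : Near a x) (hx : x ≤ 1 / 2) : a ≤ 0 := by
  by_contra! ha
  have h1 := h.2.1 ha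
  have h2 : (1 : ℝ) ≤ a := by exact_mod_cast ha
  linarith

/-! ### Fibres of the natural extension -/

/-- The fibre, over the points with digit `pt b c`, of the domain of the natural extension; the
second variable is minus the conjugate, and is given by its coordinates. -/
def Fibre (b c : ℤ) (p q : ℝ) : Prop :=
  1 / 2 < p ^ 2 + q ^ 2 ∧
  (0 < b → 1 / 2 < p ^ 2 + (q + 1) ^ 2) ∧ (b < 0 → 1 / 2 < p ^ 2 + (q - 1) ^ 2) ∧
  (0 < c → 1 / 2 < (p + 1) ^ 2 + q ^ 2) ∧ (c < 0 → 1 / 2 < (p - 1) ^ 2 + q ^ 2)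

/-- The image of `Fibre b c` under inversion. -/
def InvFibre (b c : ℤ) (r s : ℝ) : Prop :=
  r ^ 2 + s ^ 2 < 1 / 2 ∧
  (0 < b → 1 / 2 < (r + 1) ^ 2 + s ^ 2) ∧ (b < 0 → 1 / 2 < (r - 1) ^ 2 + s ^ 2) ∧
  (0 < c → 1 / 2 < r ^ 2 + (s + 1) ^ 2) ∧ (c < 0 → 1 / 2 < r ^ 2 + (s - 1) ^ 2)

/-- In these coordinates the unit circle is p² + q² = 1/2, and z ↦ 1/z is inversion in it followed
by exchanging the coordinates. The circles of squared radius 1/2 about (±1, 0) and (0, ±1) are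
orthogonal to it, so inversion preserves each of them and the exchange permutes them. -/
theorem Fibre.inv {b c : ℤ} {p q : ℝ} (h : Fibre b c p q) :
    InvFibre b c (q / (2 * (p ^ 2 + q ^ 2))) (p / (2 * (p ^ 2 + q ^ 2))) := by
  obtain ⟨h0, h1, h2, h3, h4⟩ := h
  set n := p ^ 2 + q ^ 2 with hn
  have hn0 : 0 < n := by linarith
  have e0 : (q / (2 * n)) ^ 2 + (p / (2 * n)) ^ 2 = 1 / (4 * n) := by
    field_simp; rw [hn]; ring
  have hi : 1 / (4 * n) < 1 / 2 := by
    rw [div_lt_div_iff₀ (by positivity) (by norm_num)]; linarith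
  have aux : ∀ x : ℝ, 0 < n + 2 * x + 1 / 2 → 0 < 1 / (4 * n) + 2 * (x / (2 * n)) + 1 / 2 := by
    intro x hx
    have : 1 / (4 * n) + 2 * (x / (2 * n)) + 1 / 2 = (n + 2 * x + 1 / 2) / (2 * n) := by
      field_simp; ring
    rw [this]; positivity
  refine ⟨by rw [e0]; exact hi, fun h => ?_, fun h => ?_, fun h => ?_, fun h => ?_⟩
  · linarith [aux q (by linarith [h1 h])]
  · have := aux (-q) (by linarith [h2 h])
    rw [neg_div] at this
    linarith
  · linarith [aux p (by linarith [h3 h])]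
  · have := aux (-p) (by linarith [h4 h])
    rw [neg_div] at this
    linarith

/-- Translates of the disc `r ^ 2 + s ^ 2 < 1 / 2` by an integer vector `(d, e)` that is neither
zero nor a unit vector miss the disc. -/
theorem half_lt_of_disc {r s : ℝ} (h : r ^ 2 + s ^ 2 < 1 / 2) (d e : ℤ)
    (h0 : ¬ (d = 0 ∧ e = 0))
    (h1 : d = 1 → e = 0 → 1 / 2 < (r + 1) ^ 2 + s ^ 2)
    (h2 : d = -1 → e = 0 → 1 / 2 < (r - 1) ^ 2 + s ^ 2)
    (h3 : d = 0 → e = 1 → 1 / 2 < r ^ 2 + (s + 1) ^ 2)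
    (h4 : d = 0 → e = -1 → 1 / 2 < r ^ 2 + (s - 1) ^ 2) :
    1 / 2 < (d + r) ^ 2 + (e + s) ^ 2 := by
  by_cases hu : d ^ 2 + e ^ 2 ≤ 1
  · have hd : -1 ≤ d ∧ d ≤ 1 := by constructor <;> nlinarith
    have he : -1 ≤ e ∧ e ≤ 1 := by constructor <;> nlinarith
    obtain ⟨hd1, hd2⟩ := hd
    obtain ⟨he1, he2⟩ := he
    interval_cases d <;> interval_cases e <;> norm_num at * <;> linarith
  · have hu' : (2 : ℝ) ≤ (d : ℝ) ^ 2 + (e : ℝ) ^ 2 := by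
      push Not at hu
      exact_mod_cast hu
    -- Triangle inequality: the vector (d, e) has length at least √2, and (r, s) has length less
    -- than √2/2.
    nlinarith [sq_nonneg ((d : ℝ) + 2 * r), sq_nonneg ((e : ℝ) + 2 * s)]

/-- The possible digits `pt b' c'` following a digit `pt b c`. -/
def Admissible (b c b' c' : ℤ) : Prop :=
  (b = 1 → c = 0 → 0 ≤ c') ∧ (b = -1 → c = 0 → c' ≤ 0) ∧
  (b = 0 → c = 1 → 0 ≤ b') ∧ (b = 0 → c = -1 → b' ≤ 0)

/-- Each condition on the translated point says that it avoids a disc about 0 or a unit vector, that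
is, that (r, s) translated by (b, c) or one of its four neighbours leaves the disc. This could fail
only if the neighbour were 0, and admissibility excludes that case. -/
theorem InvFibre.add {b c b' c' : ℤ} {r s : ℝ} (h : InvFibre b c r s) (h0 : ¬ (b = 0 ∧ c = 0))
    (hadm : Admissible b c b' c') : Fibre b' c' (b + r) (c + s) := by
  obtain ⟨hd, h1, h2, h3, h4⟩ := h
  obtain ⟨a1, a2, a3, a4⟩ := hadm
  have key : ∀ d e : ℤ, ¬ (d = 0 ∧ e = 0) → (d = 1 → e = 0 → 0 < b) → (d = -1 → e = 0 → b < 0) →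
      (d = 0 → e = 1 → 0 < c) → (d = 0 → e = -1 → c < 0) →
      1 / 2 < (d + r) ^ 2 + (e + s) ^ 2 := fun d e k0 k1 k2 k3 k4 =>
    half_lt_of_disc hd d e k0 (fun x y => h1 (k1 x y)) (fun x y => h2 (k2 x y))
      (fun x y => h3 (k3 x y)) (fun x y => h4 (k4 x y))
  refine ⟨key b c h0 ?_ ?_ ?_ ?_, fun h => ?_, fun h => ?_, fun h => ?_, fun h => ?_⟩
  · omega
  · omega
  · omega
  · omega
  · have := key b (c + 1) (by omega) (by omega) (by omega) (by omega) (by omega)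
    push_cast at this; linarith
  · have := key b (c - 1) (by omega) (by omega) (by omega) (by omega) (by omega)
    push_cast at this; linarith
  · have := key (b + 1) c (by omega) (by omega) (by omega) (by omega) (by omega)
    push_cast at this; linarith
  · have := key (b - 1) c (by omega) (by omega) (by omega) (by omega) (by omega)
    push_cast at this; linarith

/-- Two translated discs overlap only if their centres are adjacent. Then one centre is farther from
0 in the direction joining them, and its sign condition removes exactly the overlap. -/
theorem InvFibre.unique {b c b' c' : ℤ} {r s r' s' : ℝ} (h : InvFibre b c r s)
    (h' : InvFibre b' c' r' s') (h1 : b + r = b' + r') (h2 : c + s = c' + s') :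
    b = b' ∧ c = c' := by
  by_contra hne
  obtain ⟨hd, k1, k2, k3, k4⟩ := h
  obtain ⟨hd', k1', k2', k3', k4'⟩ := h'
  have e1 : ((b' - b : ℤ) : ℝ) + r' = r := by push_cast; linarith
  have e2 : ((c' - c : ℤ) : ℝ) + s' = s := by push_cast; linarith
  have := half_lt_of_disc hd' (b' - b) (c' - c) (by omega) ?_ ?_ ?_ ?_
  · rw [e1, e2] at this; linarith
  all_goals
    intro hx hy
    rw [hx] at e1
    rw [hy] at e2
    push_cast at e1 e2
    obtain rfl : r = _ := e1.symm
    obtain rfl : s = _ := e2.symm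
  · by_cases hb : 0 < b'
    · exact k1' hb
    · have := k2 (by omega); exfalso; ring_nf at *; linarith
  · by_cases hb : b' < 0
    · exact k2' hb
    · have := k1 (by omega); exfalso; ring_nf at *; linarith
  · by_cases hb : 0 < c'
    · exact k3' hb
    · have := k4 (by omega); exfalso; ring_nf at *; linarith
  · by_cases hb : c' < 0
    · exact k4' hb
    · have := k3 (by omega); exfalso; ring_nf at *; linarith

/-! ### Coordinates, Gaussian integers and the field of Gaussian numbers -/

theorem coords_apply (z : ℂ) : coords z = ((z.re + z.im) / 2, (z.re - z.im) / 2) := rfl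

theorem pt_coords (z : ℂ) : pt (coords z).1 (coords z).2 = z := coords.left_inv z

theorem coords_add_pt (z : ℂ) (u v : ℝ) :
    coords (z + pt u v) = ((coords z).1 + u, (coords z).2 + v) := by
  conv_lhs => rw [← pt_coords z]
  rw [pt_add, coords_pt]

theorem coords_sub_pt (z : ℂ) (u v : ℝ) :
    coords (z - pt u v) = ((coords z).1 - u, (coords z).2 - v) := by
  conv_lhs => rw [← pt_coords z]
  rw [pt_sub, coords_pt]

theorem normSq_pt (u v : ℝ) : Complex.normSq (pt u v) = 2 * (u ^ 2 + v ^ 2) := by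
  simp [pt, Complex.normSq_apply]; ring

theorem pt_re (u v : ℝ) : (pt u v).re = u + v := by simp [pt]

theorem pt_im (u v : ℝ) : (pt u v).im = u - v := by simp [pt]; ring

theorem inv_pt (u v : ℝ) :
    1 / pt u v = pt (v / (2 * (u ^ 2 + v ^ 2))) (u / (2 * (u ^ 2 + v ^ 2))) := by
  rw [one_div]
  apply Complex.ext
  · rw [Complex.inv_re, normSq_pt, pt_re, pt_re]; ring
  · rw [Complex.inv_im, normSq_pt, pt_im, pt_im]; ring

theorem coords_inv (z : ℂ) : coords (1 / z) =
    ((coords z).2 / (2 * ((coords z).1 ^ 2 + (coords z).2 ^ 2)),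
      (coords z).1 / (2 * ((coords z).1 ^ 2 + (coords z).2 ^ 2))) := by
  conv_lhs => rw [← pt_coords z, inv_pt, coords_pt]

theorem normSq_eq_coords (z : ℂ) :
    Complex.normSq z = 2 * ((coords z).1 ^ 2 + (coords z).2 ^ 2) := by
  conv_lhs => rw [← pt_coords z, normSq_pt]

theorem mem_closure_X {z : ℂ} : z ∈ closure X ↔
    (-(1 / 2) ≤ (coords z).1 ∧ (coords z).1 ≤ 1 / 2) ∧
      (-(1 / 2) ≤ (coords z).2 ∧ (coords z).2 ≤ 1 / 2) := by
  conv_lhs => rw [← pt_coords z]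
  exact pt_mem_closure

theorem mem_gaussianIntegers {z : ℂ} :
    z ∈ gaussianIntegers ↔ ∃ g : GaussianInt, z = (g : ℂ) := by
  constructor
  · rintro ⟨p, q, rfl⟩
    exact ⟨⟨p, q⟩, by simp [toComplex_def]⟩
  · rintro ⟨g, rfl⟩
    exact ⟨g.re, g.im, toComplex_def g⟩

theorem pt_intCast (a b : ℤ) : pt a b = ((⟨a + b, a - b⟩ : GaussianInt) : ℂ) := by
  rw [toComplex_def]
  simp only [pt]; push_cast; ring

/-- The field `ℚ(i)`. -/
def gaussianField : Subfield ℂ where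
  carrier := gaussianRationals
  zero_mem' := ⟨0, 0, by simp⟩
  one_mem' := ⟨1, 0, by simp⟩
  add_mem' := by
    rintro _ _ ⟨p, q, rfl⟩ ⟨p', q', rfl⟩
    exact ⟨p + p', q + q', by push_cast; ring⟩
  neg_mem' := by
    rintro _ ⟨p, q, rfl⟩
    exact ⟨-p, -q, by push_cast; ring⟩
  mul_mem' := by
    rintro _ _ ⟨p, q, rfl⟩ ⟨p', q', rfl⟩
    refine ⟨p * p' - q * q', p * q' + q * p', ?_⟩
    push_cast
    linear_combination (q * q' : ℂ) * Complex.I_sq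
  inv_mem' := by
    rintro _ ⟨p, q, rfl⟩
    refine ⟨p / (p ^ 2 + q ^ 2), -q / (p ^ 2 + q ^ 2), ?_⟩
    have e : ∀ a b : ℚ, (a : ℂ) + (b : ℂ) * Complex.I = ⟨(a : ℝ), (b : ℝ)⟩ := fun a b => by
      apply Complex.ext <;> simp
    rw [e, e]
    apply Complex.ext
    · rw [Complex.inv_re, Complex.normSq_apply]; push_cast; ring
    · rw [Complex.inv_im, Complex.normSq_apply]; push_cast; ring

theorem toComplex_mem (g : GaussianInt) : (g : ℂ) ∈ gaussianField :=
  ⟨g.re, g.im, by rw [toComplex_def]; push_cast; rfl⟩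

/-! ### Conjugate pairs -/

/-- `z` is a quadratic irrational with the discriminant of `β ^ 2`, and `-w` is its conjugate. -/
def NegConj (β z w : ℂ) : Prop :=
  ∃ P Q M : GaussianInt, Q ≠ 0 ∧ β ^ 2 = (P : ℂ) ^ 2 + Q * M ∧ z = (P + β) / Q ∧ w = (β - P) / Q

namespace NegConj

variable {β z w : ℂ}

theorem symm (h : NegConj β z w) : NegConj β w z := by
  obtain ⟨P, Q, M, hQ, hM, rfl, rfl⟩ := h
  exact ⟨-P, Q, M, hQ, by rw [hM]; simp, by simp [add_comm, sub_eq_add_neg],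
    by simp [add_comm]⟩

theorem notMem (hβ : β ∉ gaussianField) (h : NegConj β z w) : z ∉ gaussianField := by
  obtain ⟨P, Q, M, hQ, hM, rfl, rfl⟩ := h
  intro hz
  apply hβ
  have hQ' : (Q : ℂ) ≠ 0 := by simpa using hQ
  have : β = (P + β) / Q * Q - P := by field_simp; ring
  rw [this]
  exact sub_mem (mul_mem hz (toComplex_mem Q)) (toComplex_mem P)

/-- Since 1 and β are linearly independent over `ℚ(i)`, z determines Q and P. -/
theorem unique {w' : ℂ} (hβ : β ∉ gaussianField) (h : NegConj β z w) (h' : NegConj β z w') :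
    w = w' := by
  obtain ⟨P, Q, M, hQ, hM, rfl, rfl⟩ := h
  obtain ⟨P', Q', M', hQ', hM', he, rfl⟩ := h'
  have hQ1 : (Q : ℂ) ≠ 0 := by simpa using hQ
  have hQ2 : (Q' : ℂ) ≠ 0 := by simpa using hQ'
  rw [div_eq_div_iff hQ1 hQ2] at he
  have key : (Q' : ℂ) - Q = 0 := by
    by_contra hne
    apply hβ
    have : β = (P' * Q - P * Q') / (Q' - Q) := by
      rw [eq_div_iff hne]; linear_combination he
    rw [this]
    exact div_mem (sub_mem (mul_mem (toComplex_mem _) (toComplex_mem _))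
      (mul_mem (toComplex_mem _) (toComplex_mem _)))
      (sub_mem (toComplex_mem _) (toComplex_mem _))
  have hQQ : (Q' : ℂ) = Q := sub_eq_zero.1 key
  rw [hQQ] at he ⊢
  have := mul_right_cancel₀ hQ1 he
  have hP : (P : ℂ) = P' := by linear_combination this
  rw [hP]

theorem inv (hβ : β ∉ gaussianField) (h : NegConj β z w) : NegConj β (1 / z) (1 / w) := by
  have hz : z ≠ 0 := fun h0 => h.notMem hβ (h0 ▸ zero_mem _)
  have hw : w ≠ 0 := fun h0 => h.symm.notMem hβ (h0 ▸ zero_mem _)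
  obtain ⟨P, Q, M, hQ, hM, rfl, rfl⟩ := h
  have hQ1 : (Q : ℂ) ≠ 0 := by simpa using hQ
  have h1 : (P : ℂ) + β ≠ 0 := fun h => hz (by rw [h, zero_div])
  have h2 : β - (P : ℂ) ≠ 0 := fun h => hw (by rw [h, zero_div])
  have hM1 : (M : ℂ) ≠ 0 := by
    intro h0
    rw [h0, mul_zero, add_zero] at hM
    exact mul_ne_zero h1 h2 (by linear_combination hM)
  -- (P + β)(β - P) = QM, so 1/z = (β - P)/M: inversion exchanges Q and M.
  refine ⟨-P, M, Q, by simpa using hM1, by rw [hM]; simp; ring, ?_, ?_⟩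
  · rw [one_div_div, div_eq_div_iff h1 hM1]
    simp only [map_neg]
    linear_combination -hM
  · rw [one_div_div, div_eq_div_iff h2 hM1]
    simp only [map_neg]
    linear_combination -hM

theorem sub_add (h : NegConj β z w) (g : GaussianInt) : NegConj β (z - g) (w + g) := by
  obtain ⟨P, Q, M, hQ, hM, rfl, rfl⟩ := h
  have hQ1 : (Q : ℂ) ≠ 0 := by simpa using hQ
  refine ⟨P - g * Q, Q, M + 2 * P * g - g ^ 2 * Q, hQ, ?_, ?_, ?_⟩
  · rw [hM]; simp only [map_add, map_sub, map_mul, map_pow, map_ofNat]; ring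
  · simp only [map_sub, map_mul]; field_simp; ring
  · simp only [map_sub, map_mul]; field_simp; ring

theorem I_mul (h : NegConj β z w) : NegConj β (Complex.I * z) (Complex.I * w) := by
  obtain ⟨P, Q, M, hQ, hM, rfl, rfl⟩ := h
  have hQ1 : (Q : ℂ) ≠ 0 := by simpa using hQ
  have hi : ((⟨0, 1⟩ : GaussianInt) : ℂ) = Complex.I := by simp [toComplex_def]
  refine ⟨P, -(⟨0, 1⟩ * Q), ⟨0, 1⟩ * M, ?_, ?_, ?_, ?_⟩
  · rw [Ne, ← toComplex_eq_zero]; simp only [map_neg, map_mul, hi]; simp [hQ]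
  · rw [hM]; simp only [map_neg, map_mul, hi]; linear_combination (Q * M : ℂ) * Complex.I_sq
  all_goals
    simp only [map_neg, map_mul, hi]
    have := Complex.I_ne_zero
    rw [eq_div_iff (by simp [hQ])]
    field_simp
    simp

end NegConj

/-! ### The algorithm on reduced pairs -/

theorem floorH_eq {z : ℂ} (hz : z ∉ gaussianIntegers) :
    floorH z = pt (nearInt (coords z).1) (nearInt (coords z).2) := by
  rw [floorH_eq_iff hz, mem_evenGaussianIntegers]
  refine ⟨⟨_, _, rfl⟩, ?_⟩
  have := (pt_mem_cell (coords z).1 (coords z).2 (nearInt (coords z).1)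
    (nearInt (coords z).2)).2 ⟨near_nearInt _, near_nearInt _⟩
  rwa [pt_coords] at this

theorem notMem_gaussianIntegers {z : ℂ} (hz : z ∉ gaussianField) : z ∉ gaussianIntegers := by
  rintro h
  obtain ⟨g, rfl⟩ := mem_gaussianIntegers.1 h
  exact hz (toComplex_mem g)

theorem TH_eq {z : ℂ} (hz : z ∉ gaussianField) :
    TH z = 1 / z - pt (nearInt (coords (1 / z)).1) (nearInt (coords (1 / z)).2) := by
  have h0 : z ≠ 0 := fun h => hz (h ▸ zero_mem _)
  have h1 : 1 / z ∉ gaussianField := fun h => hz (by simpa using inv_mem h)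
  rw [TH, if_neg h0, floorH_eq (notMem_gaussianIntegers h1)]

theorem sub_floor_mem_closure (z : ℂ) :
    z - pt (nearInt (coords z).1) (nearInt (coords z).2) ∈ closure X := by
  rw [mem_closure_X, coords_sub_pt]
  exact ⟨(near_nearInt _).abs_sub_le, (near_nearInt _).abs_sub_le⟩

/-- `(z, -w)` is a pair of conjugates in the domain of the natural extension. -/
def Reduced (β z w : ℂ) : Prop :=
  NegConj β z w ∧ z ∈ closure X ∧
    Fibre (nearInt (coords (1 / z)).1) (nearInt (coords (1 / z)).2) (coords w).1 (coords w).2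

/-- With digit 0 both z and 1/z would lie in the closed square, hence in the closed unit disc, so
|z| = 1. The square meets the unit circle only in its corners ±1, ±i, which are in `ℚ(i)`. -/
theorem digit_ne_zero {z : ℂ} (hz : z ∉ gaussianField) (hX : z ∈ closure X) :
    ¬ (nearInt (coords (1 / z)).1 = 0 ∧ nearInt (coords (1 / z)).2 = 0) := by
  rintro ⟨h1, h2⟩
  have k1 := (near_nearInt (coords (1 / z)).1).abs_sub_le
  have k2 := (near_nearInt (coords (1 / z)).2).abs_sub_le
  rw [h1] at k1
  rw [h2] at k2
  rw [mem_closure_X] at hX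
  simp only [Int.cast_zero, sub_zero, coords_inv] at k1 k2
  have h0 : z ≠ 0 := fun h => hz (h ▸ zero_mem _)
  have hn := Complex.normSq_pos.2 h0
  rw [normSq_eq_coords] at hn
  set u := (coords z).1 with hu
  set v := (coords z).2 with hv
  rw [le_div_iff₀ hn, div_le_iff₀ hn] at k1 k2
  obtain ⟨⟨a1, a2⟩, b1, b2⟩ := hX
  have au : u ^ 2 ≤ 1 / 4 := by nlinarith
  have av : v ^ 2 ≤ 1 / 4 := by nlinarith
  have e1 : (u ^ 2 + v ^ 2) ^ 2 ≥ u ^ 2 := by nlinarith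
  have e2 : (u ^ 2 + v ^ 2) ^ 2 ≥ v ^ 2 := by nlinarith
  have hn' : u ^ 2 + v ^ 2 = 1 / 2 := by nlinarith
  have hu2 : u ^ 2 = (1 / 2) ^ 2 := by linarith
  have hv2 : v ^ 2 = (1 / 2) ^ 2 := by linarith
  apply hz
  rw [← pt_coords z, ← hu, ← hv]
  rcases sq_eq_sq_iff_eq_or_eq_neg.1 hu2 with h | h <;>
    rcases sq_eq_sq_iff_eq_or_eq_neg.1 hv2 with h' | h' <;> rw [h, h']
  · exact ⟨1, 0, by simp [pt]; ring⟩
  · exact ⟨0, 1, by simp [pt]; ring⟩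
  · exact ⟨0, -1, by simp [pt]; ring⟩
  · exact ⟨-1, 0, by simp [pt]; ring⟩

/-- Let 1/z have coordinates (x, y). For digit (1, 0), z in the square gives x ≤ x² + y²,
equivalently x - 1 ≥ -((x - 1)² + y²). This says that the second coordinate of 1/`TH z` is at least
-1/2, so its nearest integer is not negative. The other three cases are symmetric. -/
theorem admissible_digits {z : ℂ} (hz : z ∉ gaussianField) (hX : z ∈ closure X)
    (hz' : TH z ∉ gaussianField) :
    Admissible (nearInt (coords (1 / z)).1) (nearInt (coords (1 / z)).2)
      (nearInt (coords (1 / TH z)).1) (nearInt (coords (1 / TH z)).2) := by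
  have h0 : 1 / z ≠ 0 := fun h => hz (by simp at h; exact h ▸ zero_mem _)
  have h0' : TH z ≠ 0 := fun h => hz' (h ▸ zero_mem _)
  have hn := Complex.normSq_pos.2 h0
  have hn' := Complex.normSq_pos.2 h0'
  rw [normSq_eq_coords] at hn hn'
  have hzz : z = 1 / (1 / z) := by simp
  rw [mem_closure_X, hzz, coords_inv] at hX
  rw [coords_inv (TH z)]
  have hc := congrArg coords (TH_eq hz)
  rw [coords_sub_pt] at hc
  rw [hc] at hn' ⊢
  set x := (coords (1 / z)).1
  set y := (coords (1 / z)).2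
  simp only [le_div_iff₀ hn, div_le_iff₀ hn] at hX hn' ⊢
  obtain ⟨⟨a1, a2⟩, b1, b2⟩ := hX
  refine ⟨fun h1 h2 => (near_nearInt _).nonneg ?_, fun h1 h2 => (near_nearInt _).nonpos ?_,
    fun h1 h2 => (near_nearInt _).nonneg ?_, fun h1 h2 => (near_nearInt _).nonpos ?_⟩ <;>
    rw [h1, h2] at hn' ⊢ <;> push_cast at hn' ⊢
  · rw [le_div_iff₀ hn']; nlinarith
  · rw [div_le_iff₀ hn']; nlinarith
  · rw [le_div_iff₀ hn']; nlinarith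
  · rw [div_le_iff₀ hn']; nlinarith

theorem Reduced.step {β z w : ℂ} (hβ : β ∉ gaussianField) (h : Reduced β z w) :
    Reduced β (TH z)
      (1 / w + pt (nearInt (coords (1 / z)).1) (nearInt (coords (1 / z)).2)) := by
  obtain ⟨hc, hX, hF⟩ := h
  have hz := hc.notMem hβ
  have hc' : NegConj β (TH z)
      (1 / w + pt (nearInt (coords (1 / z)).1) (nearInt (coords (1 / z)).2)) := by
    rw [TH_eq hz, pt_intCast]
    exact (hc.inv hβ).sub_add _
  refine ⟨hc', by rw [TH_eq hz]; exact sub_floor_mem_closure _, ?_⟩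
  have := hF.inv.add (digit_ne_zero hz hX) (admissible_digits hz hX (hc'.notMem hβ))
  rw [coords_add_pt, coords_inv w]
  simpa only [add_comm] using this

/-- The common image determines its second variable by uniqueness of the conjugate. Disjointness of
the translated fibres then yields equal digits, and z is recovered from `TH z` and its digit. -/
theorem Reduced.TH_inj {β z w z' w' : ℂ} (hβ : β ∉ gaussianField) (h : Reduced β z w)
    (h' : Reduced β z' w') (he : TH z = TH z') : z = z' := by
  have hs := (h.step hβ).1
  have hs' := (h'.step hβ).1
  rw [← he] at hs'
  have hw := congrArg coords (hs.unique hβ hs')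
  rw [coords_add_pt, coords_add_pt, coords_inv w, coords_inv w', Prod.mk.injEq] at hw
  obtain ⟨e1, e2⟩ := h.2.2.inv.unique h'.2.2.inv (by linarith [hw.1]) (by linarith [hw.2])
  rw [TH_eq (h.1.notMem hβ), TH_eq (h'.1.notMem hβ), e1, e2] at he
  simpa using he

/-! ### Finiteness of the set of reduced points -/

theorem one_le_normSq_toComplex {g : GaussianInt} (hg : g ≠ 0) :
    1 ≤ Complex.normSq (g : ℂ) := by
  rw [← intCast_real_norm]
  exact_mod_cast GaussianInt.norm_pos.2 hg

theorem one_le_norm_toComplex {g : GaussianInt} (hg : g ≠ 0) : 1 ≤ ‖(g : ℂ)‖ := by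
  have := one_le_normSq_toComplex hg
  rw [Complex.normSq_eq_norm_sq] at this
  nlinarith [norm_nonneg (g : ℂ)]

theorem finite_norm_le (R : ℝ) : {g : GaussianInt | ‖(g : ℂ)‖ ≤ R}.Finite := by
  have hinj : Function.Injective (fun g : GaussianInt => (g.re, g.im)) := by
    intro g h hgh
    rw [Prod.mk.injEq] at hgh
    exact Zsqrtd.ext hgh.1 hgh.2
  refine (((Set.finite_Icc (-⌈R⌉) ⌈R⌉).prod (Set.finite_Icc (-⌈R⌉) ⌈R⌉)).preimage
    hinj.injOn).subset ?_
  intro g hg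
  have hg' : ‖(g : ℂ)‖ ≤ R := hg
  have h1 := (Complex.abs_re_le_norm (g : ℂ)).trans (hg'.trans (Int.le_ceil R))
  have h2 := (Complex.abs_im_le_norm (g : ℂ)).trans (hg'.trans (Int.le_ceil R))
  rw [← intCast_re] at h1
  rw [← intCast_im] at h2
  have h1' : |g.re| ≤ ⌈R⌉ := by exact_mod_cast h1
  have h2' : |g.im| ≤ ⌈R⌉ := by exact_mod_cast h2
  exact ⟨abs_le.1 h1', abs_le.1 h2'⟩

/-- If `z` is closest to the unit `1`, the denominator of a conjugate pair separated by the unit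
circle is bounded: `1 / (1 - z)` and `1 / (1 + w)` differ by a bounded amount. -/
theorem norm_denom_le {β : ℂ} (hβ : β ∉ gaussianField) {P Q M : GaussianInt} (hQ : Q ≠ 0)
    (hM : β ^ 2 = (P : ℂ) ^ 2 + Q * M) {z w : ℂ} (hz : z = (P + β) / Q) (hw : w = (β - P) / Q)
    (h1 : |z.im| ≤ z.re) (h2 : z.re + |z.im| ≤ 1) (hw1 : 1 ≤ Complex.normSq w) :
    ‖(Q : ℂ)‖ ≤ 8 * (1 / 2 + 2 * ‖β‖) * ‖β‖ := by
  have hc : NegConj β z w := ⟨P, Q, M, hQ, hM, hz, hw⟩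
  have hQ1 : (Q : ℂ) ≠ 0 := by simpa using hQ
  have hzn : 1 - z ≠ 0 := fun h => hc.notMem hβ (by
    rw [← sub_eq_zero.1 h]; exact one_mem _)
  have hwn : 1 + w ≠ 0 := fun h => hc.symm.notMem hβ (by
    rw [eq_neg_of_add_eq_zero_right h]; exact neg_mem (one_mem _))
  have hzQ : (1 - z) * Q = Q - P - β := by rw [hz]; field_simp; ring
  have hwQ : (1 + w) * Q = Q - P + β := by rw [hw]; field_simp; ring
  have hsum : (z + w) * Q = 2 * β := by rw [hz, hw]; field_simp; ring
  -- (1 - z)(1 + w)Q is a Gaussian integer because (Q - P)² - β² = Q(Q - 2P - M). Being nonzero, it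
  -- has absolute value at least 1, which bounds the difference 2β/G below.
  obtain ⟨G, hG⟩ : ∃ G : GaussianInt, (G : ℂ) = Q - 2 * P - M :=
    ⟨Q - 2 * P - M, by simp only [map_sub, map_mul, map_ofNat]⟩
  have hprod : (1 - z) * (1 + w) * Q = G := by
    apply mul_right_cancel₀ hQ1
    calc (1 - z) * (1 + w) * Q * Q = ((1 - z) * Q) * ((1 + w) * Q) := by ring
      _ = G * Q := by rw [hzQ, hwQ, hG]; linear_combination -hM
  have hG0 : G ≠ 0 := by
    rintro rfl
    exact mul_ne_zero (mul_ne_zero hzn hwn) hQ1 (by simpa using hprod)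
  have hG1 : (G : ℂ) ≠ 0 := by simpa using hG0
  have hdiff : 1 / (1 - z) - 1 / (1 + w) = 2 * β / G := by
    rw [div_sub_div _ _ hzn hwn, div_eq_div_iff (mul_ne_zero hzn hwn) hG1, ← hprod, ← hsum]
    ring
  have hre : (1 / (1 - z)).re ≤ 1 / 2 + 2 * ‖β‖ := by
    -- The map w ↦ 1/(1 + w) sends the exterior of the unit disc into the half-plane Re ≤ 1/2.
    have e1 : (1 / (1 + w)).re ≤ 1 / 2 := by
      have hp : 0 < Complex.normSq (1 + w) := Complex.normSq_pos.2 hwn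
      rw [one_div, Complex.inv_re, div_le_iff₀ hp]
      simp only [Complex.normSq_apply, Complex.add_re, Complex.add_im, Complex.one_re,
        Complex.one_im] at hw1 ⊢
      linarith
    have e2 : (2 * β / G).re ≤ 2 * ‖β‖ := by
      refine (Complex.re_le_norm _).trans ?_
      rw [norm_div, norm_mul, Complex.norm_ofNat]
      exact div_le_self (by positivity) (one_le_norm_toComplex hG0)
    rw [← hdiff, Complex.sub_re] at e2
    linarith
  set R := 1 / 2 + 2 * ‖β‖ with hR
  have hRpos : 0 < R := by positivity
  have hy := abs_nonneg z.im
  have hy2 := sq_abs z.im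
  have hx1 : 0 < 1 - z.re := by
    by_contra! h
    have hx : z.re = 1 := by linarith
    have hy0 : z.im = 0 := abs_eq_zero.1 (by linarith)
    exact hzn (Complex.ext (by simp [hx]) (by simp [hy0]))
  -- In the cone |Im z| ≤ 1 - Re z, so |1 - z|² ≤ 2(1 - Re z)². The bound on Re 1/(1 - z) therefore
  -- keeps z away from the corner 1.
  have hlow : 1 ≤ 2 * R * (1 - z.re) := by
    have hp : 0 < Complex.normSq (1 - z) := Complex.normSq_pos.2 hzn
    rw [one_div, Complex.inv_re, div_le_iff₀ hp] at hre
    simp only [Complex.normSq_apply, Complex.sub_re, Complex.sub_im, Complex.one_re,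
      Complex.one_im] at hre
    have : z.im ^ 2 ≤ (1 - z.re) ^ 2 := by rw [← hy2]; nlinarith
    have h3 : 1 - z.re ≤ 2 * R * (1 - z.re) * (1 - z.re) := by nlinarith
    nlinarith
  have hnz : ‖z‖ ^ 2 ≤ z.re := by
    rw [← Complex.normSq_eq_norm_sq, Complex.normSq_apply]
    nlinarith
  have hnw : 1 ≤ ‖w‖ := by
    rw [Complex.normSq_eq_norm_sq] at hw1
    nlinarith [norm_nonneg w]
  -- Now |z|² ≤ Re z keeps z inside the unit disc by a definite margin, while |w| ≥ 1. As (z + w)Q =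
  -- 2β, a lower bound for |z + w| bounds Q.
  have hgap : 1 ≤ 4 * R * ‖z + w‖ := by
    have h3 : ‖w‖ ≤ ‖z + w‖ + ‖z‖ := by
      have := norm_sub_le (z + w) z
      simpa using this
    have h4 : 1 - z.re ≤ 2 * (1 - ‖z‖) := by nlinarith [sq_nonneg (1 - ‖z‖)]
    have h5 : 1 - z.re ≤ 2 * ‖z + w‖ := by linarith
    nlinarith
  have hn := congrArg norm hsum
  rw [norm_mul, norm_mul, Complex.norm_ofNat] at hn
  calc ‖(Q : ℂ)‖ ≤ 4 * R * ‖z + w‖ * ‖(Q : ℂ)‖ := le_mul_of_one_le_left (norm_nonneg _) hgap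
    _ = 8 * R * ‖β‖ := by rw [mul_assoc, hn]; ring

theorem finite_cone {β : ℂ} (hβ : β ∉ gaussianField) :
    {z : ℂ | ∃ w, NegConj β z w ∧ |z.im| ≤ z.re ∧ z.re + |z.im| ≤ 1 ∧
      1 ≤ Complex.normSq w}.Finite := by
  set B := 8 * (1 / 2 + 2 * ‖β‖) * ‖β‖ with hB
  refine (((finite_norm_le (B + ‖β‖)).prod (finite_norm_le B)).image
    (fun p => ((p.1 : ℂ) + β) / (p.2 : ℂ))).subset ?_
  rintro z ⟨w, ⟨P, Q, M, hQ, hM, hz, hw⟩, h1, h2, h3⟩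
  have hb := norm_denom_le hβ hQ hM hz hw h1 h2 h3
  refine ⟨(P, Q), ⟨?_, hb⟩, hz.symm⟩
  have hQ1 : (Q : ℂ) ≠ 0 := by simpa using hQ
  have hP : (P : ℂ) = z * Q - β := by rw [hz]; field_simp; ring
  have hz1 : ‖z‖ ≤ 1 := by
    have hy := abs_nonneg z.im
    have hy2 := sq_abs z.im
    have : ‖z‖ ^ 2 ≤ 1 := by
      rw [← Complex.normSq_eq_norm_sq, Complex.normSq_apply]
      nlinarith
    nlinarith [norm_nonneg z]
  change ‖(P : ℂ)‖ ≤ B + ‖β‖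
  rw [hP]
  refine (norm_sub_le _ _).trans ?_
  rw [norm_mul]
  have := mul_le_of_le_one_left (norm_nonneg (Q : ℂ)) hz1
  linarith

theorem finite_reduced {β : ℂ} (hβ : β ∉ gaussianField) : {z : ℂ | ∃ w, Reduced β z w}.Finite := by
  have hf := finite_cone hβ
  set F := {z : ℂ | ∃ w, NegConj β z w ∧ |z.im| ≤ z.re ∧ z.re + |z.im| ≤ 1 ∧
      1 ≤ Complex.normSq w} with hF
  have hinj : Function.Injective (fun z : ℂ => Complex.I * z) :=
    mul_right_injective₀ Complex.I_ne_zero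
  have hpre : ∀ s : Set ℂ, s.Finite → ((fun z : ℂ => Complex.I * z) ⁻¹' s).Finite :=
    fun s hs => hs.preimage hinj.injOn
  refine (((hf.union (hpre _ hf)).union (hpre _ (hpre _ hf))).union
    (hpre _ (hpre _ (hpre _ hf)))).subset ?_
  rintro z ⟨w, hc, hX, hw, -⟩
  have hw1 : 1 ≤ Complex.normSq w := by rw [normSq_eq_coords]; linarith
  have hI : ∀ x : ℂ, Complex.normSq (Complex.I * x) = Complex.normSq x := fun x => by simp
  rw [mem_closure_X] at hX
  simp only [coords_apply] at hX
  -- The lines Re = ± Im cut the square into four triangles, one for each corner; a power of i turns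
  -- each into the triangle at 1 and preserves |w|.
  by_cases p1 : z.re + z.im ≤ 0 <;> by_cases p2 : z.re - z.im ≤ 0
  · refine Or.inl (Or.inr ⟨_, hc.I_mul.I_mul, ?_, ?_, by rw [hI, hI]; exact hw1⟩)
    · simp [abs_le]; constructor <;> linarith
    · simp
      rcases abs_cases z.im with h | h <;> linarith
  · refine Or.inl (Or.inl (Or.inr ⟨_, hc.I_mul, ?_, ?_, by rw [hI]; exact hw1⟩))
    · simp [abs_le]; constructor <;> linarith
    · simp
      rcases abs_cases z.re with h | h <;> linarith
  · refine Or.inr ⟨_, hc.I_mul.I_mul.I_mul, ?_, ?_, by rw [hI, hI, hI]; exact hw1⟩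
    · simp [abs_le]; constructor <;> linarith
    · simp
      rcases abs_cases z.re with h | h <;> linarith
  · refine Or.inl (Or.inl (Or.inl ⟨_, hc, ?_, ?_, hw1⟩))
    · simp [abs_le]; constructor <;> linarith
    · rcases abs_cases z.im with h | h <;> linarith

/-! ### From a finite permutation to pure periodicity -/

/-- Two iterates agree by the pigeonhole principle, and injectivity cancels the common initial
steps, leaving no preperiod. -/
theorem exists_iterate_eq_self {α : Type*} {f : α → α} {s : Set α} (hs : s.Finite)
    (hf : Set.MapsTo f s s) (hinj : Set.InjOn f s) {x : α} (hx : x ∈ s) :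
    ∃ l, 1 ≤ l ∧ f^[l] x = x := by
  have hmem : ∀ n, f^[n] x ∈ s := fun n => hf.iterate n hx
  obtain ⟨i, -, j, -, hij, he⟩ := Set.infinite_univ.exists_ne_map_eq_of_mapsTo
    (f := fun n => f^[n] x) (fun n _ => hmem n) hs
  have key : ∀ i l, f^[i + l] x = f^[i] x → f^[l] x = x := by
    intro i l h
    rw [Function.iterate_add_apply] at h
    exact hinj.iterate hf i (hmem l) hx h
  rcases lt_or_gt_of_ne hij with h | h
  · exact ⟨j - i, by omega, key i _ (by rw [Nat.add_sub_cancel' h.le]; exact he.symm)⟩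
  · exact ⟨i - j, by omega, key j _ (by rw [Nat.add_sub_cancel' h.le]; exact he)⟩

theorem sub_pt_intCast_notMem {z : ℂ} (hz : z ∉ gaussianField) (a b : ℤ) :
    z - pt a b ∉ gaussianField := by
  rw [pt_intCast]
  intro h
  have := add_mem h (toComplex_mem ⟨a + b, a - b⟩)
  rw [sub_add_cancel] at this
  exact hz this

theorem TH_notMem {z : ℂ} (hz : z ∉ gaussianField) : TH z ∉ gaussianField := by
  rw [TH_eq hz]
  exact sub_pt_intCast_notMem (fun h => hz (by simpa using inv_mem h)) _ _

theorem isPurelyPeriodicH_of_iterate {α : ℂ} (hX : α ∈ closure X) (hα : α ∉ gaussianField) {l : ℕ}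
    (hl : 1 ≤ l) (h : TH^[l] α = α) : IsPurelyPeriodicH α := by
  refine ⟨hX, fun n _ h0 => ?_, l, hl, fun n hn => ?_⟩
  · have : ∀ n, TH^[n] α ∉ gaussianField := by
      intro n
      induction n with
      | zero => exact hα
      | succ n ih => rw [Function.iterate_succ_apply']; exact TH_notMem ih
    exact this (n - 1) (by rw [alphaH] at h0; rw [h0]; exact zero_mem _)
  · have : alphaH α (n + l) = alphaH α n := by
      rw [alphaH, alphaH, Nat.sub_add_comm hn, Function.iterate_add_apply, h]
    exact ⟨this, by rw [digitH, digitH, this]⟩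

/-- Since ⌊β⌋ ≠ 0 is close to β, the sum β + ⌊β⌋ is roughly 2β and far from 0. It satisfies all the
fibre inequalities whatever the signs, so the first digit of α need not be known. -/
theorem reduced_sub_floorH {β : ℂ} (hβ : β ∉ gaussianField) (g : GaussianInt) (hg : β ^ 2 = g)
    (hn : 1 < Complex.normSq β) : Reduced β (β - floorH β) (β + floorH β) := by
  rw [floorH_eq (notMem_gaussianIntegers hβ)]
  refine ⟨?_, sub_floor_mem_closure _, ?_⟩
  · rw [pt_intCast]
    exact NegConj.sub_add ⟨0, 1, g, one_ne_zero, by simp [hg], by simp, by simp⟩ _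
  rw [coords_add_pt]
  rw [normSq_eq_coords] at hn
  obtain ⟨u1, u2⟩ := (near_nearInt (coords β).1).abs_sub_le
  obtain ⟨v1, v2⟩ := (near_nearInt (coords β).2).abs_sub_le
  set p := (coords β).1
  set q := (coords β).2
  set a := nearInt p
  set b := nearInt q
  have hab : ¬ (a = 0 ∧ b = 0) := by
    rintro ⟨h1, h2⟩
    rw [h1] at u1 u2
    rw [h2] at v1 v2
    push_cast at *
    nlinarith
  have far : ∀ (x : ℝ) (c : ℤ), c ≠ 0 → -(1 / 2) ≤ x - c → x - c ≤ 1 / 2 →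
      1 / 2 < (x + c) ^ 2 ∧ (c ≠ -1 → 1 / 2 < (x + c + 1) ^ 2) ∧
        (c ≠ 1 → 1 / 2 < (x + c - 1) ^ 2) := by
    intro x c hc h1 h2
    rcases lt_or_gt_of_ne hc with h | h
    · have h' : (c : ℝ) ≤ -1 := by exact_mod_cast Int.le_sub_one_of_lt h
      refine ⟨by nlinarith, fun h3 => ?_, fun _ => by nlinarith⟩
      have : (c : ℝ) ≤ -2 := by exact_mod_cast (by omega : c ≤ -2)
      nlinarith
    · have h' : (1 : ℝ) ≤ c := by exact_mod_cast h
      refine ⟨by nlinarith, fun _ => by nlinarith, fun h3 => ?_⟩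
      have : (2 : ℝ) ≤ c := by exact_mod_cast (by omega : 2 ≤ c)
      nlinarith
  have shift : ∀ (x y : ℝ) (c d : ℤ), ¬ (c = 0 ∧ d = 0) → -(1 / 2) ≤ x - c → x - c ≤ 1 / 2 →
      -(1 / 2) ≤ y - d → y - d ≤ 1 / 2 → 1 / 2 < x ^ 2 + y ^ 2 →
      1 / 2 < (x + c) ^ 2 + (y + d) ^ 2 ∧ 1 / 2 < (x + c) ^ 2 + (y + d + 1) ^ 2 ∧
        1 / 2 < (x + c) ^ 2 + (y + d - 1) ^ 2 := by
    intro x y c d h0 h1 h2 h3 h4 h5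
    by_cases hc : c = 0
    · have hd : d ≠ 0 := fun h => h0 ⟨hc, h⟩
      obtain ⟨f1, f2, f3⟩ := far y d hd h3 h4
      refine ⟨by nlinarith [sq_nonneg (x + c)], ?_, ?_⟩
      · by_cases hd1 : d = -1
        -- The tight case: when ⌊β⌋ is a unit vector in coordinates, removing it from β + ⌊β⌋ gives
        -- β back, and |β| > 1 is exactly what is needed.
        · rw [hc, hd1]; push_cast; ring_nf at *; linarith
        · nlinarith [sq_nonneg (x + c), f2 hd1]
      · by_cases hd1 : d = 1
        · rw [hc, hd1]; push_cast; ring_nf at *; linarith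
        · nlinarith [sq_nonneg (x + c), f3 hd1]
    · obtain ⟨f1, -, -⟩ := far x c hc h1 h2
      exact ⟨by nlinarith [sq_nonneg (y + d)], by nlinarith [sq_nonneg (y + d + 1)],
        by nlinarith [sq_nonneg (y + d - 1)]⟩
  obtain ⟨s1, s2, s3⟩ := shift p q a b hab u1 u2 v1 v2 (by linarith)
  obtain ⟨-, t2, t3⟩ := shift q p b a (by tauto) v1 v2 u1 u2 (by linarith)
  exact ⟨s1, fun _ => s2, fun _ => s3, fun _ => by linarith, fun _ => by linarith⟩

/-! ### The boundary case |β| = 1 -/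

theorem nearInt_zero : nearInt 0 = 0 := nearInt_eq ((near_zero 0).2 (by norm_num))

theorem TH_pt_zero_right {u : ℝ} (h : pt u 0 ∉ gaussianField) :
    TH (pt u 0) = pt 0 (1 / (2 * u) - nearInt (1 / (2 * u))) := by
  have h0 : u ≠ 0 := by rintro rfl; exact h (by simp [pt, zero_mem])
  have e : u / (2 * (u ^ 2 + 0 ^ 2)) = 1 / (2 * u) := by field_simp; ring
  rw [TH_eq h, inv_pt, coords_pt, pt_sub, zero_div, nearInt_zero, e]
  simp

theorem TH_pt_zero_left {v : ℝ} (h : pt 0 v ∉ gaussianField) :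
    TH (pt 0 v) = pt (1 / (2 * v) - nearInt (1 / (2 * v))) 0 := by
  have h0 : v ≠ 0 := by rintro rfl; exact h (by simp [pt, zero_mem])
  have e : v / (2 * (0 ^ 2 + v ^ 2)) = 1 / (2 * v) := by field_simp; ring
  rw [TH_eq h, inv_pt, coords_pt, pt_sub, zero_div, nearInt_zero, e]
  simp

/-- For `s = ±√(1/2)` the algorithm, restricted to a coordinate axis, has a cycle of length two. -/
theorem exists_two_cycle {s : ℝ} (hs : s ^ 2 = 1 / 2) : ∃ t : ℝ,
    1 / (2 * (s - nearInt s)) - nearInt (1 / (2 * (s - nearInt s))) = t ∧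
    1 / (2 * t) - nearInt (1 / (2 * t)) = s - nearInt s := by
  rcases lt_or_gt_of_ne (show s ≠ 0 by rintro rfl; norm_num at hs) with h | h
  · have l1 : s < -(1 / 2) := by nlinarith
    have l2 : -1 < s := by nlinarith
    have n1 : nearInt s = -1 :=
      nearInt_eq ((near_neg (by norm_num) _).2 ⟨by push_cast; linarith, by push_cast; linarith⟩)
    have e1 : 1 / (2 * (s + 1)) = 1 - s := by
      rw [div_eq_iff (by linarith)]; linarith
    have n2 : nearInt (1 - s) = 2 :=
      nearInt_eq ((near_pos (by norm_num) _).2 ⟨by push_cast; linarith, by push_cast; linarith⟩)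
    have e2 : 1 / (2 * (-1 - s)) = s - 1 := by
      rw [div_eq_iff (by linarith)]; linarith
    have n3 : nearInt (s - 1) = -2 :=
      nearInt_eq ((near_neg (by norm_num) _).2 ⟨by push_cast; linarith, by push_cast; linarith⟩)
    -- From s² = 1/2 one has 2(s + 1)(1 - s) = 1, so the orbit is s + 1 ↦ (1 - s) - 2 = -1 - s ↦ (s
    -- - 1) + 2 = s + 1.
    refine ⟨-1 - s, ?_, ?_⟩
    · rw [n1]; push_cast; rw [sub_neg_eq_add, e1, n2]; push_cast; ring
    · rw [n1, e2, n3]; push_cast; ring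
  · have l1 : 1 / 2 < s := by nlinarith
    have l2 : s < 1 := by nlinarith
    have n1 : nearInt s = 1 :=
      nearInt_eq ((near_pos (by norm_num) _).2 ⟨by push_cast; linarith, by push_cast; linarith⟩)
    have e1 : 1 / (2 * (s - 1)) = -1 - s := by
      rw [div_eq_iff (by linarith)]; linarith
    have n2 : nearInt (-1 - s) = -2 :=
      nearInt_eq ((near_neg (by norm_num) _).2 ⟨by push_cast; linarith, by push_cast; linarith⟩)
    have e2 : 1 / (2 * (1 - s)) = s + 1 := by
      rw [div_eq_iff (by linarith)]; linarith
    have n3 : nearInt (s + 1) = 2 :=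
      nearInt_eq ((near_pos (by norm_num) _).2 ⟨by push_cast; linarith, by push_cast; linarith⟩)
    refine ⟨1 - s, ?_, ?_⟩
    · rw [n1]; push_cast; rw [e1, n2]; push_cast; ring
    · rw [n1, e2, n3]; push_cast; ring

theorem sub_floorH_notMem {β : ℂ} (hβ : β ∉ gaussianField) : β - floorH β ∉ gaussianField := by
  rw [floorH_eq (notMem_gaussianIntegers hβ)]
  exact sub_pt_intCast_notMem hβ _ _

/-- Each step of `TH` exchanges the two coordinate axes, so two steps return to the original axis
and the real two-cycle closes up. -/
theorem iterate_two_of_axis {β : ℂ} (hβ : β ∉ gaussianField) {s : ℝ} (hs : s ^ 2 = 1 / 2)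
    (h : β = pt s 0 ∨ β = pt 0 s) : TH^[2] (β - floorH β) = β - floorH β := by
  have h1 := sub_floorH_notMem hβ
  have h2 := TH_notMem h1
  obtain ⟨t, ht1, ht2⟩ := exists_two_cycle hs
  change TH (TH _) = _
  rw [floorH_eq (notMem_gaussianIntegers hβ)] at h1 h2 ⊢
  rcases h with rfl | rfl
  · rw [coords_pt, nearInt_zero, Int.cast_zero, pt_sub, sub_zero] at h1 h2 ⊢
    rw [TH_pt_zero_right h1, ht1] at h2 ⊢
    rw [TH_pt_zero_left h2, ht2]
  · rw [coords_pt, nearInt_zero, Int.cast_zero, pt_sub, sub_zero] at h1 h2 ⊢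
    rw [TH_pt_zero_left h1, ht1] at h2 ⊢
    rw [TH_pt_zero_right h2, ht2]

/-- Here m + ni is a unit. The values ±1 would put β in `ℚ(i)`, so m = 0; in coordinates Re β² =
4pq, hence p or q vanishes. -/
theorem eq_axis_of_normSq_eq_one {β : ℂ} (hβ : β ∉ gaussianField) {m n : ℤ}
    (h : β ^ 2 = (m : ℂ) + (n : ℂ) * Complex.I) (h1 : Complex.normSq β = 1) :
    ∃ s : ℝ, s ^ 2 = 1 / 2 ∧ (β = pt s 0 ∨ β = pt 0 s) := by
  have hre := congrArg Complex.re h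
  have him := congrArg Complex.im h
  rw [← pt_coords β] at hre him ⊢
  rw [normSq_eq_coords] at h1
  set p := (coords β).1 with hp
  set q := (coords β).2 with hq
  simp [pow_two, pt_re, pt_im] at hre him
  have hmn : m ^ 2 + n ^ 2 = 1 := by
    have : (m : ℝ) ^ 2 + (n : ℝ) ^ 2 = 1 := by
      rw [← hre, ← him]
      calc _ = (2 * (p ^ 2 + q ^ 2)) ^ 2 := by ring
        _ = 1 := by rw [h1]; norm_num
    exact_mod_cast this
  by_cases hm : m = 0
  · rw [hm, Int.cast_zero] at hre
    have : p * q = 0 := by linarith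
    rcases mul_eq_zero.1 this with h0 | h0
    · exact ⟨q, by rw [h0] at h1; linarith, Or.inr (by rw [h0])⟩
    · exact ⟨p, by rw [h0] at h1; linarith, Or.inl (by rw [h0])⟩
  · exfalso
    have hm2 : 1 ≤ m ^ 2 := by have := sq_pos_of_ne_zero hm (R := ℤ); omega
    have hn0 : n = 0 := by
      have : n ^ 2 = 0 := by nlinarith
      exact pow_eq_zero_iff (two_ne_zero) |>.1 this
    have hI : Complex.I ∈ gaussianField := ⟨0, 1, by simp⟩
    have hm1 : m = 1 ∨ m = -1 := by
      rw [hn0] at hmn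
      exact sq_eq_sq_iff_eq_or_eq_neg.1 (by linarith : m ^ 2 = 1 ^ 2)
    rcases hm1 with rfl | rfl
    · have : β ^ 2 = 1 ^ 2 := by rw [h, hn0]; simp
      rcases sq_eq_sq_iff_eq_or_eq_neg.1 this with e | e
      · exact hβ (e ▸ one_mem _)
      · exact hβ (e ▸ neg_mem (one_mem _))
    · have : β ^ 2 = Complex.I ^ 2 := by rw [h, hn0]; simp
      rcases sq_eq_sq_iff_eq_or_eq_neg.1 this with e | e
      · exact hβ (e ▸ hI)
      · exact hβ (e ▸ neg_mem hI)

end JHurwitz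

theorem theorem6p4 (m n : ℤ) (β : ℂ) (hβ : β ^ 2 = (m : ℂ) + (n : ℂ) * Complex.I)
    (hirr : β ∉ JHurwitz.gaussianRationals) :
    JHurwitz.IsPurelyPeriodicH (β - JHurwitz.floorH β) := by
  have hβ' : β ∉ JHurwitz.gaussianField := hirr
  have hX : β - JHurwitz.floorH β ∈ closure JHurwitz.X := by
    rw [JHurwitz.floorH_eq (JHurwitz.notMem_gaussianIntegers hβ')]
    exact JHurwitz.sub_floor_mem_closure _
  have hα := JHurwitz.sub_floorH_notMem hβ'
  have hg : β ^ 2 = GaussianInt.toComplex ⟨m, n⟩ := by rw [hβ, GaussianInt.toComplex_def']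
  have h1 : 1 ≤ Complex.normSq β := by
    have h0 : (⟨m, n⟩ : GaussianInt) ≠ 0 := by
      intro h
      rw [h, map_zero] at hg
      exact hβ' (pow_eq_zero_iff two_ne_zero |>.1 hg ▸ zero_mem _)
    have := JHurwitz.one_le_normSq_toComplex h0
    rw [← hg, map_pow] at this
    nlinarith [Complex.normSq_nonneg β]
  -- β² is a nonzero Gaussian integer, so |β| ≥ 1; only equality escapes the strict inequalities of
  -- the fibres.
  rcases h1.eq_or_lt with h1 | h1
  · obtain ⟨s, hs, h⟩ := JHurwitz.eq_axis_of_normSq_eq_one hβ' hβ h1.symm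
    exact JHurwitz.isPurelyPeriodicH_of_iterate hX hα one_le_two
      (JHurwitz.iterate_two_of_axis hβ' hs h)
  · obtain ⟨l, hl, h⟩ := JHurwitz.exists_iterate_eq_self (JHurwitz.finite_reduced hβ')
      (fun z ⟨_, hw⟩ => ⟨_, hw.step hβ'⟩)
      (fun z ⟨_, hw⟩ z' ⟨_, hw'⟩ he => hw.TH_inj hβ' hw' he)
      ⟨_, JHurwitz.reduced_sub_floorH hβ' _ hg h1⟩
    exact JHurwitz.isPurelyPeriodicH_of_iterate hX hα hl h
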